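/- Let $X$ be a $\sigma$-compact topological space and $\lambda$ a Borel probability measure on $X$ that is inner regular, i.e. $\lambda(B)=\sup\{\lambda(C) : C\subset B \text{ compact and Borel}\}$ for every Borel set $B$ (this is automatic if $X$ is metrizable). Let $f:X\to X$ be a Borel measurable map for which $\lambda$ is quasi-invariant ($f_*\lambda\ll\lambda$), and suppose that $f$ is ergodic and conservative with respect to $\lambda$. A $\lambda$-partition of $X$ is a (finite or infinite) countable collection $\mathcal G$ of pairwise disjoint $\sigma$-compact Borel sets $I$ with $0<\lambda(I)<\infty$ and $\lambda\big(X\setminus\bigcup_{I\in\mathcal G}I\big)=0$. For a $\lambda$-partition $\mathcal G$, let $\mathcal M_s(\mathcal G,f)$ be the set of all $\sigma$-finite Borel measures $\mu\ll\lambda$ on $X$ such that for every $I\in\mathcal G$ there is a $K>0$ with 1. $\frac1K\le\mu(I)\le K$; 2. for all $n\ge 0$, $0<\mu(f^{-n}(I))<\infty$, and for all measurable $A\subset I$ $$\frac1K\,\frac{\lambda(A)}{\lambda(I)}\le\frac{\mu(f^{-n}(A))}{\mu(f^{-n}(I))}\le K\,\frac{\lambda(A)}{\lambda(I)};$$ and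 such that $\sup_{n\ge0}\mu(f^{-n}(I))<\infty$ for every $I\in\mathcal G$. Then $f$ has a nonzero $\sigma$-finite invariant measure that is absolutely continuous with respect to $\lambda$ if and only if there is a $\lambda$-partition $\mathcal G$ of $X$ with $\mathcal M_s(\mathcal G,f)\neq\emptyset$. -/

import Mathlib

open MeasureTheory Set
open scoped ENNReal NNReal

/-- A countable family of pairwise disjoint Borel, σ-compact sets of positive finite `lam`-measure
that covers `lam`-almost all of `X`. The family may be finite or infinite. -/
structure IsLambdaPartition {X : Type*} [TopologicalSpace X] [MeasurableSpace X]
    (lam : Measure X) (G : Set (Set X)) : Prop where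
  countable : G.Countable
  pairwiseDisjoint : G.PairwiseDisjoint id
  measurableSet : ∀ I ∈ G, MeasurableSet I
  isSigmaCompact : ∀ I ∈ G, IsSigmaCompact I
  measure_pos : ∀ I ∈ G, 0 < lam I
  measure_lt_top : ∀ I ∈ G, lam I < ∞
  measure_compl : lam (⋃₀ G)ᶜ = 0

/-- The density of `ν` with respect to `lam` has, on the set `I` of finite `ν`-measure,
distortion bounded by `K`. -/
structure HasDistortionBoundedBy {X : Type*} [MeasurableSpace X]
    (lam ν : Measure X) (I : Set X) (K : ℝ≥0) : Prop where
  absolutelyContinuous : ν ≪ lam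
  measure_lt_top : ν I < ∞
  lower : ∀ A ⊆ I, MeasurableSet A → (K : ℝ≥0∞)⁻¹ * (lam A / lam I) ≤ ν A / ν I
  upper : ∀ A ⊆ I, MeasurableSet A → ν A / ν I ≤ K * (lam A / lam I)

/-- Property m1: `μ(I) ∈ [1/K, K]`. -/
def PropM1 {X : Type*} [MeasurableSpace X] (μ : Measure X) (I : Set X) (K : ℝ≥0) : Prop :=
  μ I ∈ Icc (K : ℝ≥0∞)⁻¹ (K : ℝ≥0∞)

/-- Property m2: all `μ(f⁻ⁿ(I))` are positive and finite, and all push-forwards of `μ` under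
the iterates of `f` have distortion bounded by `K` on `I`. -/
def PropM2 {X : Type*} [MeasurableSpace X] (lam : Measure X) (f : X → X) (μ : Measure X)
    (I : Set X) (K : ℝ≥0) : Prop :=
  ∀ n : ℕ, 0 < μ (f^[n] ⁻¹' I) ∧ μ (f^[n] ⁻¹' I) < ∞ ∧
    HasDistortionBoundedBy lam (μ.map f^[n]) I K

/-- Property m3: `sup_n μ(f⁻ⁿ(I)) < ∞`. -/
def PropM3 {X : Type*} [MeasurableSpace X] (f : X → X) (μ : Measure X) (I : Set X) : Prop :=
  ⨆ n : ℕ, μ (f^[n] ⁻¹' I) < ∞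

/-- The set `𝓜(G, f)` of σ-finite measures with m1 and m2 on every element of `G`. -/
def MeasM {X : Type*} [MeasurableSpace X] (lam : Measure X) (G : Set (Set X)) (f : X → X) :
    Set (Measure X) :=
  {μ | SigmaFinite μ ∧ ∀ I ∈ G, ∃ K : ℝ≥0, 0 < K ∧ PropM1 μ I K ∧ PropM2 lam f μ I K}

/-- The set `𝓜_s(G, f)` of the elements of `𝓜(G, f)` with m3 on every element of `G`. -/
def MeasMs {X : Type*} [MeasurableSpace X] (lam : Measure X) (G : Set (Set X)) (f : X → X) :
    Set (Measure X) :=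
  {μ | μ ∈ MeasM lam G f ∧ ∀ I ∈ G, PropM3 f μ I}

/-- `μ` is a (nonzero) σ-finite, `lam`-absolutely continuous, `f`-invariant measure. -/
structure IsAcim {X : Type*} [MeasurableSpace X] (lam : Measure X) (f : X → X)
    (μ : Measure X) : Prop where
  ne_zero : μ ≠ 0
  sigmaFinite : SigmaFinite μ
  absolutelyContinuous : μ ≪ lam
  invariant : MeasurePreserving f μ μ

/-!
Conservativity and ergodicity say that almost every orbit visits every set `B` of positive measure
infinitely often, so that `∑ ν (f⁻ⁿ B) = ∞` for every nonzero `ν ≪ lam`.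

An invariant `μ ≪ lam` is therefore equivalent to `lam`. Where both densities `dμ/dlam` and
`dlam/dμ` are at most `n`, the distortion of `μ` is at most `n²`, and by invariance the same holds
for all `f^n_* μ = μ`. Inner regularity replaces these sets by σ-compact ones.

Conversely, let `μ ∈ 𝓜_s(G, f)` and fix `J ∈ G`. Since a part of each `I ∈ G` visits `J` and
distortion is bounded, the orbit sums `∑_{i < N} f^i_* μ`, normalized to have mass `1` on `J`, are
dominated on `I` by a multiple of `lam` independent of `N`. Their ultrafilter limit on the pieces
of `G` is a σ-finite `ν ≪ lam` with `ν J = 1`. As mass may escape through infinitely many pieces,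
one only gets `f_* ν ≤ ν`, but the defect `δ = ν - f_* ν` satisfies
`∑ δ (f⁻ⁿ B) ≤ ν B < ∞` for a set `B` of positive measure, which forces `δ = 0`.
-/

open Filter Topology Function

section Recurrence

variable {X : Type*} [MeasurableSpace X] {lam : Measure X} {f : X → X}

theorem ae_frequently_iterate_mem (herg : QuasiErgodic f lam) (hcons : Conservative f lam)
    {B : Set X} (hB : MeasurableSet B) (hB0 : lam B ≠ 0) :
    ∀ᵐ x ∂lam, ∃ᶠ n in atTop, f^[n] x ∈ B := by
  simp_rw [← mem_preimage, ← mem_limsup_iff_frequently_mem]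
  have hmeas : MeasurableSet (limsup (fun n => f^[n] ⁻¹' B) atTop) :=
    .measurableSet_limsup fun n => herg.measurable.iterate n hB
  have hinv : f ⁻¹' limsup (fun n => f^[n] ⁻¹' B) atTop = limsup (fun n => f^[n] ⁻¹' B) atTop := by
    simp only [preimage_iterate_eq]
    exact (CompleteLatticeHom.setPreimage f).apply_limsup_iterate B
  refine (herg.toPreErgodic.ae_mem_or_ae_notMem hmeas hinv).resolve_right fun hnot => hB0 ?_
  rw [measure_eq_zero_iff_ae_notMem]
  filter_upwards [hnot, hcons.ae_mem_imp_frequently_image_mem hB.nullMeasurableSet]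
    with x hx hrec hxB
  exact hx (mem_limsup_iff_frequently_mem.2 (hrec hxB))

theorem tsum_measure_preimage_iterate_eq_top (herg : QuasiErgodic f lam)
    (hcons : Conservative f lam) {B : Set X} (hB : MeasurableSet B) (hB0 : lam B ≠ 0)
    {ν : Measure X} (hν : ν ≪ lam) (hν0 : ν ≠ 0) :
    ∑' n : ℕ, ν (f^[n] ⁻¹' B) = ∞ := by
  by_contra hfin
  have hrare : ∀ᵐ x ∂ν, ¬ ∃ᶠ n in atTop, f^[n] x ∈ B :=
    measure_eq_zero_iff_ae_notMem.1 (measure_setOfPred_frequently_eq_zero hfin)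
  have hfalse : ∀ᵐ _ ∂ν, False := by
    filter_upwards [hrare, hν.ae_le (ae_frequently_iterate_mem herg hcons hB hB0)] with x h h'
      using h h'
  exact hν0 (ae_eq_bot.1 (eventually_false_iff_eq_bot.1 hfalse))

theorem exists_measure_inter_preimage_iterate_ne_zero (herg : QuasiErgodic f lam)
    (hcons : Conservative f lam) {A B : Set X} (hA0 : lam A ≠ 0) (hB : MeasurableSet B)
    (hB0 : lam B ≠ 0) : ∃ k : ℕ, lam (A ∩ f^[k] ⁻¹' B) ≠ 0 := by
  have hsum : ∑' k : ℕ, lam.restrict A (f^[k] ⁻¹' B) = ∞ :=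
    tsum_measure_preimage_iterate_eq_top herg hcons hB hB0
      Measure.restrict_le_self.absolutelyContinuous (Measure.restrict_eq_zero.not.2 hA0)
  contrapose! hsum
  simp [Measure.restrict_apply (herg.measurable.iterate _ hB), inter_comm _ A, hsum]

theorem IsAcim.absolutelyContinuous_symm {μ : Measure X} (hμ : IsAcim lam f μ)
    (herg : QuasiErgodic f lam) (hcons : Conservative f lam) : lam ≪ μ := by
  refine Measure.AbsolutelyContinuous.mk fun B hB hμB => ?_
  by_contra hB0
  have hsum := tsum_measure_preimage_iterate_eq_top herg hcons hB hB0
    hμ.absolutelyContinuous hμ.ne_zero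
  simp [(hμ.invariant.iterate _).measure_preimage hB.nullMeasurableSet, hμB] at hsum

theorem exists_absolutelyContinuous_add_eq_of_le {μ ν : Measure X} [SigmaFinite ν] (h : μ ≤ ν) :
    ∃ δ : Measure X, δ ≪ ν ∧ δ + μ = ν := by
  have : SigmaFinite μ := Measure.sigmaFinite_of_le ν h
  refine ⟨ν.withDensity (1 - μ.rnDeriv ν), withDensity_absolutelyContinuous _ _, ?_⟩
  calc ν.withDensity (1 - μ.rnDeriv ν) + μ
      = ν.withDensity (1 - μ.rnDeriv ν) + ν.withDensity (μ.rnDeriv ν) := by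
        rw [Measure.withDensity_rnDeriv_eq _ _ (Measure.absolutelyContinuous_of_le h)]
    _ = ν.withDensity (1 - μ.rnDeriv ν + μ.rnDeriv ν) :=
        (withDensity_add_right _ (Measure.measurable_rnDeriv _ _)).symm
    _ = ν.withDensity 1 := withDensity_congr_ae <| by
        filter_upwards [Measure.rnDeriv_le_one_of_le h] with x hx using tsub_add_cancel_of_le hx
    _ = ν := withDensity_one

theorem sum_measure_preimage_iterate_add_eq {δ ν : Measure X} (hf : Measurable f)
    (h : δ + ν.map f = ν) {B : Set X} (hB : MeasurableSet B) (n : ℕ) :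
    ∑ i ∈ Finset.range n, δ (f^[i] ⁻¹' B) + ν (f^[n] ⁻¹' B) = ν B := by
  induction n with
  | zero => simp
  | succ n ih =>
    have hstep : δ (f^[n] ⁻¹' B) + ν (f^[n + 1] ⁻¹' B) = ν (f^[n] ⁻¹' B) := by
      conv_rhs => rw [← h, Measure.add_apply, Measure.map_apply hf (hf.iterate n hB)]
      rw [iterate_succ, preimage_comp]
    rw [Finset.sum_range_succ, add_assoc, hstep, ih]

theorem measurePreserving_of_map_le (herg : QuasiErgodic f lam) (hcons : Conservative f lam)
    {ν : Measure X} [SigmaFinite ν] (hν : ν ≪ lam) (hle : ν.map f ≤ ν) :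
    MeasurePreserving f ν ν := by
  have hf : Measurable f := herg.measurable
  refine ⟨hf, ?_⟩
  obtain ⟨δ, hδν, hδ⟩ := exists_absolutelyContinuous_add_eq_of_le hle
  suffices hδ0 : δ = 0 by rwa [hδ0, zero_add] at hδ
  by_contra hδ0
  have hν0 : 0 < ν univ := pos_iff_ne_zero.2 fun h => hδ0 (Measure.measure_univ_eq_zero.1 (hδν h))
  obtain ⟨n, hn⟩ := (Measure.exists_measure_inter_spanningSets_pos univ).2 hν0
  have hB : MeasurableSet (spanningSets ν n) := measurableSet_spanningSets ν n
  have hB0 : lam (spanningSets ν n) ≠ 0 := fun h => hn.ne' (by simpa using hν h)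
  have hsum : ∑' i : ℕ, δ (f^[i] ⁻¹' spanningSets ν n) = ∞ :=
    tsum_measure_preimage_iterate_eq_top herg hcons hB hB0 (hδν.trans hν) hδ0
  refine (measure_spanningSets_lt_top ν n).ne (top_le_iff.1 (hsum ▸ ?_))
  refine ENNReal.tsum_le_of_sum_range_le fun N => ?_
  exact le_self_add.trans_eq (sum_measure_preimage_iterate_add_eq hf hδ hB N)

end Recurrence

section SetwiseLimit

variable {X ι κ : Type*} [MeasurableSpace X]

theorem tendsto_ennreal_tsum_of_dominated {l : Filter ι} [l.NeBot] {a : ι → κ → ℝ≥0∞}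
    {b L : κ → ℝ≥0∞} (hb : ∑' k, b k ≠ ∞) (hab : ∀ i k, a i k ≤ b k)
    (ha : ∀ k, Tendsto (fun i => a i k) l (𝓝 (L k))) :
    Tendsto (fun i => ∑' k, a i k) l (𝓝 (∑' k, L k)) := by
  have hLb : ∀ k, L k ≤ b k := fun k => le_of_tendsto' (ha k) fun i => hab i k
  have hb' : ∀ k, b k ≠ ∞ := ENNReal.ne_top_of_tsum_ne_top hb
  have ha' : ∀ i k, a i k ≠ ∞ := fun i k => ne_top_of_le_ne_top (hb' k) (hab i k)
  have hL' : ∀ k, L k ≠ ∞ := fun k => ne_top_of_le_ne_top (hb' k) (hLb k)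
  have hreal : Tendsto (fun i => ∑' k, (a i k).toReal) l (𝓝 (∑' k, (L k).toReal)) :=
    tendsto_tsum_of_dominated_convergence (ENNReal.summable_toReal hb)
      (fun k => (ENNReal.tendsto_toReal (hL' k)).comp (ha k)) <| .of_forall fun i k => by
        simpa using ENNReal.toReal_mono (hb' k) (hab i k)
  simp_rw [← ENNReal.tsum_toReal_eq (ha' _), ← ENNReal.tsum_toReal_eq hL'] at hreal
  exact (ENNReal.tendsto_toReal_iff
    (fun i => ne_top_of_le_ne_top hb (ENNReal.tsum_le_tsum (hab i)))
    (ne_top_of_le_ne_top hb (ENNReal.tsum_le_tsum hLb))).1 hreal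

theorem exists_measure_tendsto_of_le (U : Ultrafilter ι) {m : ι → Measure X} {ρ : Measure X}
    [IsFiniteMeasure ρ] (hm : ∀ i, m i ≤ ρ) :
    ∃ ν ≤ ρ, ∀ A, MeasurableSet A → Tendsto (fun i => m i A) U (𝓝 (ν A)) := by
  choose L hL using fun A : Set X =>
    (⟨_, (U.map fun i => m i A).le_nhds_lim⟩ : ∃ a, Tendsto (fun i => m i A) U (𝓝 a))
  have hLρ : ∀ A, L A ≤ ρ A := fun A => le_of_tendsto' (hL A) fun i => hm i A
  have hempty : L ∅ = 0 := by simpa using hLρ ∅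
  have hunion : ∀ s : ℕ → Set X, (∀ k, MeasurableSet (s k)) → Pairwise (Disjoint on s) →
      L (⋃ k, s k) = ∑' k, L (s k) := fun s hs hd => by
    have hsum : Tendsto (fun i => ∑' k, m i (s k)) U (𝓝 (∑' k, L (s k))) :=
      tendsto_ennreal_tsum_of_dominated (measure_iUnion hd hs ▸ measure_ne_top ρ _)
        (fun i k => hm i (s k)) fun k => hL (s k)
    exact tendsto_nhds_unique (hL _) (hsum.congr fun i => (measure_iUnion hd hs).symm)
  have hν : ∀ A, MeasurableSet A → Measure.ofMeasurable (fun A _ => L A) hempty hunion A = L A :=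
    fun A hA => Measure.ofMeasurable_apply A hA
  exact ⟨Measure.ofMeasurable (fun A _ => L A) hempty hunion,
    Measure.le_iff.2 fun A hA => (hν A hA).trans_le (hLρ A), fun A hA => (hν A hA).symm ▸ hL A⟩

theorem restrict_le_restrict_iff_forall_subset {μ ν : Measure X} {s : Set X}
    (hs : MeasurableSet s) :
    μ.restrict s ≤ ν.restrict s ↔ ∀ A ⊆ s, MeasurableSet A → μ A ≤ ν A := by
  refine ⟨fun h A hAs _ => ?_, fun h => Measure.le_iff.2 fun A hA => ?_⟩
  · simpa only [Measure.restrict_eq_self _ hAs] using h A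
  · simpa only [Measure.restrict_apply hA] using h (A ∩ s) inter_subset_right (hA.inter hs)

theorem sum_restrict_eq_self [Countable κ] {s : κ → Set X} (hs : ∀ k, MeasurableSet (s k))
    (hd : Pairwise (Disjoint on s)) {μ : Measure X} (hμ : μ (⋃ k, s k)ᶜ = 0) :
    Measure.sum (fun k => μ.restrict (s k)) = μ := by
  rw [← Measure.restrict_iUnion hd hs]
  exact Measure.restrict_eq_self_of_ae_mem (mem_ae_iff.2 hμ)

theorem measure_sum_mono {μ ν : κ → Measure X} (h : ∀ k, μ k ≤ ν k) :
    Measure.sum μ ≤ Measure.sum ν :=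
  Measure.le_iff.2 fun A hA => by
    simpa only [Measure.sum_apply _ hA] using ENNReal.tsum_le_tsum fun k => h k A

/-- `ν` is the limit of the measures `m i` on the measurable subsets of each piece `s k`, and lives
on the union of the pieces. Mass of `m i` may escape through infinitely many pieces, so that
`m i A` need not converge to `ν A` for a set `A` that meets infinitely many of them. -/
structure IsPiecewiseLimit (s : κ → Set X) (l : Filter ι) (m : ι → Measure X) (ν : Measure X) :
    Prop where
  tendsto : ∀ k, ∀ A ⊆ s k, MeasurableSet A → Tendsto (fun i => m i A) l (𝓝 (ν A))
  measure_compl : ν (⋃ k, s k)ᶜ = 0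

theorem sigmaFinite_of_measure_iUnion_compl_eq_zero [Countable κ] {s : κ → Set X} {ν : Measure X}
    (hν : ν (⋃ k, s k)ᶜ = 0) (hfin : ∀ k, ν (s k) < ∞) : SigmaFinite ν := by
  refine Measure.sigmaFinite_of_countable ((countable_range s).insert (⋃ k, s k)ᶜ) ?_ ?_
  · rintro _ (rfl | ⟨k, rfl⟩)
    · exact hν.trans_lt ENNReal.zero_lt_top
    · exact hfin k
  · rw [sUnion_insert, sUnion_range, compl_union_self]

theorem exists_isPiecewiseLimit [Countable κ] {s : κ → Set X} (hs : ∀ k, MeasurableSet (s k))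
    (hd : Pairwise (Disjoint on s)) (U : Ultrafilter ι) {m : ι → Measure X} {ρ : κ → Measure X}
    [∀ k, IsFiniteMeasure (ρ k)] (hm : ∀ k i, (m i).restrict (s k) ≤ ρ k) :
    ∃ ν, IsPiecewiseLimit s U m ν ∧ SigmaFinite ν ∧ ν ≤ Measure.sum ρ := by
  choose p hpρ hp using fun k => exists_measure_tendsto_of_le U (hm k)
  have hp_zero : ∀ k A, MeasurableSet A → Disjoint A (s k) → p k A = 0 := fun k A hA hAs =>
    tendsto_nhds_unique (hp k A hA) <| by
      simp [Measure.restrict_apply hA, hAs.inter_eq]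
  have hsum : ∀ k, ∀ A ⊆ s k, MeasurableSet A → Measure.sum p A = p k A := fun k A hAs hA => by
    rw [Measure.sum_apply _ hA]
    exact tsum_eq_single k fun j hj => hp_zero j A hA ((hd hj.symm).mono_left hAs)
  have hcompl : Measure.sum p (⋃ k, s k)ᶜ = 0 := Measure.sum_apply_eq_zero.2 fun k =>
    hp_zero k _ (MeasurableSet.iUnion hs).compl
      (disjoint_compl_left.mono_right (subset_iUnion s k))
  refine ⟨Measure.sum p, ⟨fun k A hAs hA => ?_, hcompl⟩,
    sigmaFinite_of_measure_iUnion_compl_eq_zero hcompl fun k => ?_, measure_sum_mono hpρ⟩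
  · simpa only [hsum k A hAs hA, Measure.restrict_eq_self _ hAs] using hp k A hA
  · rw [hsum k _ subset_rfl (hs k)]
    exact (hpρ k _).trans_lt (measure_lt_top _ _)

variable {s : κ → Set X} {l : Filter ι} {m : ι → Measure X} {ν : Measure X}

theorem IsPiecewiseLimit.measure_le_liminf [Countable κ] [l.NeBot]
    (h : IsPiecewiseLimit s l m ν) (hs : ∀ k, MeasurableSet (s k)) (hd : Pairwise (Disjoint on s))
    {B : Set X} (hB : MeasurableSet B) : ν B ≤ liminf (fun i => m i B) l := by
  have hBs : ∀ k, MeasurableSet (B ∩ s k) := fun k => hB.inter (hs k)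
  have hνB : ν B = ∑' k, ν (B ∩ s k) := by
    conv_lhs => rw [← sum_restrict_eq_self hs hd h.measure_compl]
    simp only [Measure.sum_apply _ hB, Measure.restrict_apply hB]
  rw [hνB, ENNReal.tsum_eq_iSup_sum]
  refine iSup_le fun F => ?_
  have hF : Tendsto (fun i => ∑ k ∈ F, m i (B ∩ s k)) l (𝓝 (∑ k ∈ F, ν (B ∩ s k))) :=
    tendsto_finsetSum _ fun k _ => h.tendsto k _ inter_subset_right (hBs k)
  rw [← hF.liminf_eq]
  refine liminf_le_liminf (.of_forall fun i => ?_)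
  calc ∑ k ∈ F, m i (B ∩ s k) = m i (⋃ k ∈ F, B ∩ s k) := (measure_biUnion_finset
        (fun j _ k _ hjk => (hd hjk).mono inter_subset_right inter_subset_right)
        fun k _ => hBs k).symm
    _ ≤ m i B := measure_mono (iUnion₂_subset fun _ _ => inter_subset_left)

theorem IsPiecewiseLimit.map_le [Countable κ] [l.NeBot] (h : IsPiecewiseLimit s l m ν)
    (hs : ∀ k, MeasurableSet (s k)) (hd : Pairwise (Disjoint on s)) {f : X → X}
    (hf : Measurable f) (hnull : ν (f ⁻¹' (⋃ k, s k)ᶜ) = 0) {ε : κ → ι → ℝ≥0∞}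
    (hε : ∀ k, Tendsto (ε k) l (𝓝 0))
    (hdec : ∀ k, ∀ A ⊆ s k, MeasurableSet A → ∀ i, m i (f ⁻¹' A) ≤ m i A + ε k i) :
    ν.map f ≤ ν := by
  have hpiece : ∀ k, (ν.map f).restrict (s k) ≤ ν.restrict (s k) := fun k =>
    (restrict_le_restrict_iff_forall_subset (hs k)).2 fun A hAs hA => by
      have hlim : Tendsto (fun i => m i A + ε k i) l (𝓝 (ν A)) := by
        simpa using (h.tendsto k A hAs hA).add (hε k)
      calc ν.map f A = ν (f ⁻¹' A) := Measure.map_apply hf hA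
        _ ≤ liminf (fun i => m i (f ⁻¹' A)) l := h.measure_le_liminf hs hd (hf hA)
        _ ≤ liminf (fun i => m i A + ε k i) l :=
            liminf_le_liminf (.of_forall (hdec k A hAs hA))
        _ = ν A := hlim.liminf_eq
  have hcompl : ν.map f (⋃ k, s k)ᶜ = 0 := by
    rwa [Measure.map_apply hf (MeasurableSet.iUnion hs).compl]
  calc ν.map f = Measure.sum fun k => (ν.map f).restrict (s k) :=
        (sum_restrict_eq_self hs hd hcompl).symm
    _ ≤ Measure.sum fun k => ν.restrict (s k) := measure_sum_mono hpiece
    _ = ν := sum_restrict_eq_self hs hd h.measure_compl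

end SetwiseLimit

section OrbitSum

variable {X : Type*} [MeasurableSpace X] {lam μ : Measure X} {f : X → X} {I J : Set X} {K : ℝ≥0}

/-- The sum `∑_{i < N} f^i_* μ` of the first `N` push-forwards of `μ`. -/
noncomputable def orbitSum (f : X → X) (μ : Measure X) (N : ℕ) : Measure X :=
  ∑ i ∈ Finset.range N, μ.map f^[i]

theorem orbitSum_apply (hf : Measurable f) {A : Set X} (hA : MeasurableSet A) (N : ℕ) :
    orbitSum f μ N A = ∑ i ∈ Finset.range N, μ (f^[i] ⁻¹' A) := by
  simp only [orbitSum, Measure.coe_finsetSum, Finset.sum_apply,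
    Measure.map_apply (hf.iterate _) hA]

theorem orbitSum_preimage_le (hf : Measurable f) {A : Set X} (hA : MeasurableSet A) (N : ℕ) :
    orbitSum f μ N (f ⁻¹' A) ≤ orbitSum f μ N A + μ (f^[N] ⁻¹' A) := by
  simp only [orbitSum_apply hf hA, orbitSum_apply hf (hf hA), ← preimage_comp, ← iterate_succ']
  rw [← Finset.sum_range_succ, Finset.sum_range_succ']
  exact le_self_add

theorem tendsto_orbitSum_top (herg : QuasiErgodic f lam) (hcons : Conservative f lam)
    (hμ : μ ≪ lam) (hμ0 : μ ≠ 0) (hJ : MeasurableSet J) (hJ0 : lam J ≠ 0) :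
    Tendsto (fun N => orbitSum f μ N J) atTop (𝓝 ∞) := by
  simp only [orbitSum_apply herg.measurable hJ]
  rw [← tsum_measure_preimage_iterate_eq_top herg hcons hJ hJ0 hμ hμ0]
  exact ENNReal.tendsto_nat_tsum _

theorem sum_measure_preimage_iterate_add_le (hf : Measurable f) (hJ : MeasurableSet J) (k N : ℕ) :
    ∑ i ∈ Finset.range N, μ (f^[k + i] ⁻¹' J) ≤
      orbitSum f μ N J + k * ⨆ n : ℕ, μ (f^[n] ⁻¹' J) :=
  calc ∑ i ∈ Finset.range N, μ (f^[k + i] ⁻¹' J)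
      ≤ ∑ i ∈ Finset.range (k + N), μ (f^[i] ⁻¹' J) := by
        rw [Finset.sum_range_add]; exact le_add_self
    _ = orbitSum f μ N J + ∑ i ∈ Finset.range k, μ (f^[N + i] ⁻¹' J) := by
        rw [add_comm k, Finset.sum_range_add, orbitSum_apply hf hJ]
    _ ≤ orbitSum f μ N J + k * ⨆ n : ℕ, μ (f^[n] ⁻¹' J) := by
        gcongr
        simpa using Finset.sum_le_card_nsmul (Finset.range k) _ _ fun i _ =>
          le_iSup (fun n => μ (f^[n] ⁻¹' J)) (N + i)

theorem HasDistortionBoundedBy.restrict_le {ν : Measure X}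
    (h : HasDistortionBoundedBy lam ν I K) (hI : MeasurableSet I) (hν : ν I ≠ 0) :
    ν.restrict I ≤ (K / lam I * ν I) • lam.restrict I := by
  rw [← Measure.restrict_smul, restrict_le_restrict_iff_forall_subset hI]
  intro A hAI hA
  calc ν A ≤ K * (lam A / lam I) * ν I :=
        (ENNReal.div_le_iff hν h.measure_lt_top.ne).1 (h.upper A hAI hA)
    _ = K / lam I * ν I * lam A := by simp only [div_eq_mul_inv]; ring

theorem HasDistortionBoundedBy.measure_le_mul {ν : Measure X}
    (h : HasDistortionBoundedBy lam ν I K) (hK : K ≠ 0) (hν : ν I ≠ 0) (hI : lam I ≠ ∞)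
    {A : Set X} (hAI : A ⊆ I) (hA : MeasurableSet A) (hA0 : lam A ≠ 0) :
    ν I ≤ K * (lam I / lam A) * ν A := by
  have hI0 : lam I ≠ 0 := fun h0 => hA0 (measure_mono_null hAI h0)
  have hlower : (K : ℝ≥0∞)⁻¹ * (lam A / lam I) * ν I ≤ ν A :=
    (ENNReal.le_div_iff_mul_le (.inl hν) (.inl h.measure_lt_top.ne)).1 (h.lower A hAI hA)
  have hinv : ((K : ℝ≥0∞)⁻¹ * (lam A / lam I))⁻¹ = K * (lam I / lam A) := by
    rw [ENNReal.mul_inv (.inl (by simp)) (.inl (by simpa using hK)), inv_inv,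
      ENNReal.inv_div (.inl hI) (.inl hI0)]
  rw [← hinv, ← ENNReal.div_eq_inv_mul, ENNReal.le_div_iff_mul_le]
  · rwa [mul_comm]
  · exact .inl (mul_ne_zero (by simp) (ENNReal.div_ne_zero.2 ⟨hA0, hI⟩))
  · exact .inl (ENNReal.mul_ne_top (by simpa using hK)
      (ENNReal.div_ne_top (measure_ne_top_of_subset hAI hI) hI0))

theorem PropM2.map_iterate_ne_zero (h : PropM2 lam f μ I K) (hf : Measurable f)
    (hI : MeasurableSet I) (n : ℕ) : μ.map f^[n] I ≠ 0 := by
  rw [Measure.map_apply (hf.iterate n) hI]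
  exact (h n).1.ne'

theorem PropM2.orbitSum_restrict_le (h : PropM2 lam f μ I K) (hf : Measurable f)
    (hI : MeasurableSet I) (N : ℕ) :
    (orbitSum f μ N).restrict I ≤ (K / lam I * orbitSum f μ N I) • lam.restrict I := by
  induction N with
  | zero => simp [orbitSum]
  | succ N ih =>
    have hsucc : orbitSum f μ (N + 1) = orbitSum f μ N + μ.map f^[N] := Finset.sum_range_succ _ _
    rw [hsucc, Measure.restrict_add, Measure.add_apply, mul_add, add_smul]
    exact add_le_add ih ((h N).2.2.restrict_le hI (h.map_iterate_ne_zero hf hI N))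

theorem PropM2.exists_measure_preimage_iterate_le (h : PropM2 lam f μ I K)
    (herg : QuasiErgodic f lam) (hcons : Conservative f lam) (hK : K ≠ 0) (hI : MeasurableSet I)
    (hI0 : lam I ≠ 0) (hItop : lam I ≠ ∞) (hJ : MeasurableSet J) (hJ0 : lam J ≠ 0) :
    ∃ c : ℝ≥0∞, c ≠ ∞ ∧ ∃ k, ∀ n, μ (f^[n] ⁻¹' I) ≤ c * μ (f^[k + n] ⁻¹' J) := by
  have hf : Measurable f := herg.measurable
  obtain ⟨k, hk⟩ := exists_measure_inter_preimage_iterate_ne_zero herg hcons hI0 hJ hJ0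
  have hB : MeasurableSet (I ∩ f^[k] ⁻¹' J) := hI.inter (hf.iterate k hJ)
  refine ⟨K * (lam I / lam (I ∩ f^[k] ⁻¹' J)), ENNReal.mul_ne_top (by simp)
    (ENNReal.div_ne_top hItop hk), k, fun n => ?_⟩
  have hle := (h n).2.2.measure_le_mul hK (h.map_iterate_ne_zero hf hI n) hItop
    inter_subset_left hB hk
  rw [Measure.map_apply (hf.iterate n) hI, Measure.map_apply (hf.iterate n) hB] at hle
  refine hle.trans ?_
  gcongr
  rw [iterate_add, preimage_comp]
  exact preimage_mono inter_subset_right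

theorem PropM2.exists_orbitSum_le (h : PropM2 lam f μ I K) (herg : QuasiErgodic f lam)
    (hcons : Conservative f lam) (hK : K ≠ 0) (hI : MeasurableSet I) (hI0 : lam I ≠ 0)
    (hItop : lam I ≠ ∞) (hJ : MeasurableSet J) (hJ0 : lam J ≠ 0) (hμJ : μ J ≠ 0)
    (hsup : PropM3 f μ J) :
    ∃ R : ℝ≥0∞, R ≠ ∞ ∧ ∀ N, orbitSum f μ N I ≤ R * orbitSum f μ N J := by
  have hf : Measurable f := herg.measurable
  obtain ⟨c, hc, k, hck⟩ := h.exists_measure_preimage_iterate_le herg hcons hK hI hI0 hItop hJ hJ0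
  set M := ⨆ n : ℕ, μ (f^[n] ⁻¹' J)
  have hμJtop : μ J ≠ ∞ := ((le_iSup (fun n => μ (f^[n] ⁻¹' J)) 0).trans_lt hsup).ne
  have hkM : k * M / μ J ≠ ∞ := ENNReal.div_ne_top (ENNReal.mul_ne_top (by simp) hsup.ne) hμJ
  refine ⟨c * (1 + k * M / μ J), ENNReal.mul_ne_top hc (by finiteness), fun N => ?_⟩
  rcases N with _ | N
  · simp [orbitSum]
  have hJN : μ J ≤ orbitSum f μ (N + 1) J := by
    rw [orbitSum_apply hf hJ, Finset.sum_range_succ']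
    exact le_add_self
  calc orbitSum f μ (N + 1) I
      ≤ ∑ i ∈ Finset.range (N + 1), c * μ (f^[k + i] ⁻¹' J) := by
        rw [orbitSum_apply hf hI]
        exact Finset.sum_le_sum fun i _ => hck i
    _ ≤ c * (orbitSum f μ (N + 1) J + k * M) := by
        rw [← Finset.mul_sum]
        gcongr
        exact sum_measure_preimage_iterate_add_le hf hJ k (N + 1)
    _ = c * (orbitSum f μ (N + 1) J + k * M / μ J * μ J) := by
        rw [ENNReal.div_mul_cancel hμJ hμJtop]
    _ ≤ c * (orbitSum f μ (N + 1) J + k * M / μ J * orbitSum f μ (N + 1) J) := by gcongr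
    _ = c * (1 + k * M / μ J) * orbitSum f μ (N + 1) J := by ring

/-- The orbit sum of `μ` rescaled to give mass `1` to the reference set `J`. Where
`orbitSum f μ N J` is `0` or `∞`, in particular for `N = 0`, it is a junk value. -/
noncomputable def normalizedOrbitSum (f : X → X) (μ : Measure X) (J : Set X) (N : ℕ) : Measure X :=
  (orbitSum f μ N J)⁻¹ • orbitSum f μ N

theorem normalizedOrbitSum_self (hf : Measurable f) (hJ : MeasurableSet J) (hμJ : μ J ≠ 0)
    (hfin : ∀ n, μ (f^[n] ⁻¹' J) ≠ ∞) {N : ℕ} (hN : N ≠ 0) : normalizedOrbitSum f μ J N J = 1 := by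
  refine ENNReal.inv_mul_cancel ?_ ?_ <;> rw [orbitSum_apply hf hJ]
  · exact fun h0 => hμJ (Finset.sum_eq_zero_iff.1 h0 0 (Finset.mem_range.2 (pos_iff_ne_zero.2 hN)))
  · exact ENNReal.sum_ne_top.2 fun i _ => hfin i

theorem normalizedOrbitSum_preimage_le (hf : Measurable f) {A : Set X} (hA : MeasurableSet A)
    (hAI : A ⊆ I) (N : ℕ) :
    normalizedOrbitSum f μ J N (f ⁻¹' A) ≤
      normalizedOrbitSum f μ J N A + (orbitSum f μ N J)⁻¹ * ⨆ n : ℕ, μ (f^[n] ⁻¹' I) := by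
  simp only [normalizedOrbitSum, Measure.smul_apply, smul_eq_mul, ← mul_add]
  gcongr
  refine (orbitSum_preimage_le hf hA N).trans ?_
  gcongr
  exact le_iSup_of_le N (measure_mono (preimage_mono hAI))

theorem PropM2.exists_normalizedOrbitSum_restrict_le (h : PropM2 lam f μ I K)
    (herg : QuasiErgodic f lam) (hcons : Conservative f lam) (hK : K ≠ 0) (hI : MeasurableSet I)
    (hI0 : lam I ≠ 0) (hItop : lam I ≠ ∞) (hJ : MeasurableSet J) (hJ0 : lam J ≠ 0) (hμJ : μ J ≠ 0)
    (hsup : PropM3 f μ J) :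
    ∃ c : ℝ≥0∞, c ≠ ∞ ∧ ∀ N, (normalizedOrbitSum f μ J N).restrict I ≤ c • lam.restrict I := by
  obtain ⟨R, hR, hIJ⟩ := h.exists_orbitSum_le herg hcons hK hI hI0 hItop hJ hJ0 hμJ hsup
  refine ⟨K / lam I * R, ENNReal.mul_ne_top (ENNReal.div_ne_top (by simp) hI0) hR, fun N A => ?_⟩
  rw [normalizedOrbitSum, Measure.restrict_smul]
  calc (orbitSum f μ N J)⁻¹ * (orbitSum f μ N).restrict I A
      ≤ (orbitSum f μ N J)⁻¹ * (K / lam I * (R * orbitSum f μ N J) * lam.restrict I A) := by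
        gcongr
        refine (h.orbitSum_restrict_le herg.measurable hI N A).trans ?_
        rw [Measure.smul_apply, smul_eq_mul]
        gcongr
        exact hIJ N
    _ = (orbitSum f μ N J)⁻¹ * orbitSum f μ N J * (K / lam I * R * lam.restrict I A) := by ring
    _ ≤ K / lam I * R * lam.restrict I A := mul_le_of_le_one_left' (ENNReal.inv_mul_le_one _)

end OrbitSum

section LambdaPartition

variable {X : Type*} [TopologicalSpace X] [MeasurableSpace X] {lam μ : Measure X} {f : X → X}
  {G : Set (Set X)}

theorem IsLambdaPartition.nonempty [NeZero lam] (hG : IsLambdaPartition lam G) : G.Nonempty := by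
  rw [nonempty_iff_ne_empty]
  rintro rfl
  exact NeZero.ne lam (by simpa using hG.measure_compl)

theorem IsLambdaPartition.exists_isPiecewiseLimit_normalizedOrbitSum (hG : IsLambdaPartition lam G)
    (herg : QuasiErgodic f lam) (hcons : Conservative f lam) (hμ : μ ∈ MeasMs lam G f)
    {J : Set X} (hJ : J ∈ G) (U : Ultrafilter ℕ) :
    ∃ ν, IsPiecewiseLimit (fun I : G => I.1) U (normalizedOrbitSum f μ J) ν ∧ SigmaFinite ν ∧
      ν ≪ lam := by
  have : Countable G := hG.countable
  choose! K hK _ hM2 using hμ.1.2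
  have hμJ : μ J ≠ 0 := (hM2 J hJ 0).1.ne'
  choose c hc hle using fun I : G => (hM2 I I.2).exists_normalizedOrbitSum_restrict_le herg hcons
    (hK I I.2).ne' (hG.measurableSet I I.2) (hG.measure_pos I I.2).ne' (hG.measure_lt_top I I.2).ne
    (hG.measurableSet J hJ) (hG.measure_pos J hJ).ne' hμJ (hμ.2 J hJ)
  have hfinite : ∀ I : G, IsFiniteMeasure (c I • lam.restrict I) := fun I =>
    have : Fact (lam I < ∞) := ⟨hG.measure_lt_top I I.2⟩
    Measure.smul_finite _ (hc I)
  obtain ⟨ν, hlim, hσ, hνle⟩ := exists_isPiecewiseLimit (fun I : G => hG.measurableSet I I.2)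
    hG.pairwiseDisjoint.subtype U hle
  exact ⟨ν, hlim, hσ, (Measure.absolutelyContinuous_of_le hνle).trans <|
    Measure.absolutelyContinuous_sum_left fun I =>
      Measure.smul_absolutelyContinuous.trans Measure.restrict_le_self.absolutelyContinuous⟩

theorem IsLambdaPartition.exists_isAcim [NeZero lam] (hG : IsLambdaPartition lam G)
    (herg : QuasiErgodic f lam) (hcons : Conservative f lam) (hμ : μ ∈ MeasMs lam G f) :
    ∃ ν, IsAcim lam f ν := by
  have : Countable G := hG.countable
  obtain ⟨J, hJ⟩ := hG.nonempty
  have hJm : MeasurableSet J := hG.measurableSet J hJ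
  obtain ⟨K, -, -, hM2⟩ := hμ.1.2 J hJ
  have hμJ : μ J ≠ 0 := (hM2 0).1.ne'
  have hμac : μ ≪ lam := by simpa using (hM2 0).2.2.absolutelyContinuous
  have hμ0 : μ ≠ 0 := fun h0 => hμJ (by simp [h0])
  have htop : Tendsto (fun N => orbitSum f μ N J) (hyperfilter ℕ) (𝓝 ∞) :=
    (tendsto_orbitSum_top herg hcons hμac hμ0 hJm (hG.measure_pos J hJ).ne').mono_left
      Nat.hyperfilter_le_atTop
  obtain ⟨ν, hlim, hσ, hνac⟩ :=
    hG.exists_isPiecewiseLimit_normalizedOrbitSum herg hcons hμ hJ (hyperfilter ℕ)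
  have hνJ : ν J = 1 := tendsto_nhds_unique_of_eventuallyEq (hlim.tendsto ⟨J, hJ⟩ J subset_rfl hJm)
    tendsto_const_nhds <| Nat.hyperfilter_le_atTop <| by
      filter_upwards [eventually_ne_atTop 0] with N hN
      exact normalizedOrbitSum_self herg.measurable hJm hμJ (fun n => (hM2 n).2.1.ne) hN
  have hnull : ν (f ⁻¹' (⋃ I : G, I.1)ᶜ) = 0 := hνac <|
    herg.toQuasiMeasurePreserving.preimage_null (sUnion_eq_iUnion ▸ hG.measure_compl)
  have herror : ∀ I : G, Tendsto (fun N => (orbitSum f μ N J)⁻¹ * ⨆ n : ℕ, μ (f^[n] ⁻¹' I))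
      (hyperfilter ℕ) (𝓝 0) := fun I => by
    rw [← zero_mul (⨆ n : ℕ, μ (f^[n] ⁻¹' I))]
    exact ENNReal.Tendsto.mul_const (by simpa using htop.inv) (.inr (hμ.2 I I.2).ne)
  have hmap : ν.map f ≤ ν := hlim.map_le (fun I => hG.measurableSet I I.2)
    hG.pairwiseDisjoint.subtype herg.measurable hnull herror fun I A hAI hA N =>
      normalizedOrbitSum_preimage_le herg.measurable hA hAI N
  refine ⟨ν, ⟨fun h0 => ?_, hσ, hνac, measurePreserving_of_map_le herg hcons hνac hmap⟩⟩
  simp [h0] at hνJ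

end LambdaPartition

section Comparable

variable {X : Type*} [MeasurableSpace X] {lam μ ν : Measure X} {f : X → X} {I : Set X}
  {C K : ℝ≥0}

/-- `μ` and `ν` agree up to the factor `C` on the subsets of `I`: each has density at
most `C` with respect to the other there. -/
structure ComparableOn (μ ν : Measure X) (I : Set X) (C : ℝ≥0) : Prop where
  le : ∀ A ⊆ I, μ A ≤ C * ν A
  ge : ∀ A ⊆ I, ν A ≤ C * μ A

theorem ComparableOn.mono (h : ComparableOn μ ν I C) {J : Set X} (hJI : J ⊆ I) :
    ComparableOn μ ν J C :=
  ⟨fun A hA => h.le A (hA.trans hJI), fun A hA => h.ge A (hA.trans hJI)⟩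

theorem measure_le_mul_of_rnDeriv_le [μ.HaveLebesgueDecomposition ν] [SFinite ν] (hμν : μ ≪ ν)
    {c : ℝ≥0∞} {A : Set X} (hA : ∀ x ∈ A, μ.rnDeriv ν x ≤ c) : μ A ≤ c * ν A :=
  calc μ A = ∫⁻ x in A, μ.rnDeriv ν x ∂ν := (Measure.setLIntegral_rnDeriv hμν A).symm
    _ ≤ ∫⁻ _ in A, c ∂ν := setLIntegral_mono measurable_const hA
    _ = c * ν A := setLIntegral_const A c

theorem exists_iUnion_comparableOn [SigmaFinite μ] [SigmaFinite ν] (hμν : μ ≪ ν) (hνμ : ν ≪ μ) :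
    ∃ E : ℕ → Set X, (∀ n, MeasurableSet (E n)) ∧ (∀ n, ν (E n) < ∞) ∧ ν (⋃ n, E n)ᶜ = 0 ∧
      ∀ n, ComparableOn μ ν (E n) n := by
  refine ⟨fun n => {x | μ.rnDeriv ν x ≤ n} ∩ {x | ν.rnDeriv μ x ≤ n} ∩ spanningSets ν n,
    fun n => ?_, fun n => ?_, ?_, fun n => ⟨fun A hA => ?_, fun A hA => ?_⟩⟩
  · exact ((measurableSet_le (Measure.measurable_rnDeriv μ ν) measurable_const).inter
      (measurableSet_le (Measure.measurable_rnDeriv ν μ) measurable_const)).inter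
      (measurableSet_spanningSets ν n)
  · exact (measure_mono inter_subset_right).trans_lt (measure_spanningSets_lt_top ν n)
  · rw [measure_eq_zero_iff_ae_notMem]
    filter_upwards [Measure.rnDeriv_lt_top μ ν, hνμ.ae_le (Measure.rnDeriv_lt_top ν μ)]
      with x hxμ hxν
    obtain ⟨a, ha⟩ := ENNReal.exists_nat_gt hxμ.ne
    obtain ⟨b, hb⟩ := ENNReal.exists_nat_gt hxν.ne
    have hax : ∀ᶠ n : ℕ in atTop, μ.rnDeriv ν x ≤ n :=
      (eventually_ge_atTop a).mono fun n hn => ha.le.trans (by exact_mod_cast hn)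
    have hbx : ∀ᶠ n : ℕ in atTop, ν.rnDeriv μ x ≤ n :=
      (eventually_ge_atTop b).mono fun n hn => hb.le.trans (by exact_mod_cast hn)
    have hspan : ∀ᶠ n : ℕ in atTop, x ∈ spanningSets ν n :=
      (eventually_ge_atTop _).mono fun n hn =>
        monotone_spanningSets ν hn (mem_spanningSetsIndex ν x)
    obtain ⟨n, hn⟩ := ((hax.and hbx).and hspan).exists
    exact notMem_compl_iff.2 (mem_iUnion.2 ⟨n, hn⟩)
  · exact measure_le_mul_of_rnDeriv_le hμν fun x hx => by simpa using (hA hx).1.1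
  · exact measure_le_mul_of_rnDeriv_le hνμ fun x hx => by simpa using (hA hx).1.2

theorem measure_div_le_of_le_mul {A : Set X} {a b : ℝ≥0∞} (hA : μ A ≤ a * ν A)
    (hI : ν I ≤ b * μ I) (hI0 : ν I ≠ 0) (hItop : ν I ≠ ∞) (hμI0 : μ I ≠ 0) (hμI : μ I ≠ ∞) :
    μ A / μ I ≤ a * b * (ν A / ν I) := by
  rw [ENNReal.div_le_iff hμI0 hμI]
  calc μ A ≤ a * ν A := hA
    _ = a * (ν A / ν I * ν I) := by rw [ENNReal.div_mul_cancel hI0 hItop]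
    _ ≤ a * (ν A / ν I * (b * μ I)) := by gcongr
    _ = a * b * (ν A / ν I) * μ I := by ring

theorem HasDistortionBoundedBy.mono (h : HasDistortionBoundedBy lam ν I C) (hCK : C ≤ K) :
    HasDistortionBoundedBy lam ν I K where
  absolutelyContinuous := h.absolutelyContinuous
  measure_lt_top := h.measure_lt_top
  lower A hAI hA := le_trans (by gcongr) (h.lower A hAI hA)
  upper A hAI hA := (h.upper A hAI hA).trans (by gcongr)

theorem ComparableOn.hasDistortionBoundedBy (h : ComparableOn μ lam I C) (hμ : μ ≪ lam)
    (hI0 : lam I ≠ 0) (hItop : lam I ≠ ∞) :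
    HasDistortionBoundedBy lam μ I (C ^ 2) := by
  have hμI : μ I ≠ ∞ := ne_top_of_le_ne_top (by finiteness) (h.le I subset_rfl)
  have hμI0 : μ I ≠ 0 := fun h0 => hI0 (by simpa [h0] using h.ge I subset_rfl)
  refine ⟨hμ, hμI.lt_top, fun A hAI _ => ?_, fun A hAI _ => ?_⟩
  · rw [mul_comm, ← div_eq_mul_inv]
    refine ENNReal.div_le_of_le_mul' ?_
    simpa [pow_two] using measure_div_le_of_le_mul (h.ge A hAI) (h.le I subset_rfl)
      hμI0 hμI hI0 hItop
  · simpa [pow_two] using measure_div_le_of_le_mul (h.le A hAI) (h.ge I subset_rfl)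
      hI0 hItop hμI0 hμI

theorem exists_propM1 (hI0 : μ I ≠ 0) (hItop : μ I ≠ ∞) (C : ℝ≥0) :
    ∃ K, 0 < K ∧ C ≤ K ∧ PropM1 μ I K := by
  lift μ I to ℝ≥0 using hItop with a ha
  have ha0 : a ≠ 0 := by simpa using hI0
  refine ⟨C + a + a⁻¹, by positivity, le_self_add.trans le_self_add, ?_, ?_⟩
  · rw [← ha, ENNReal.inv_le_iff_inv_le, ← ENNReal.coe_inv ha0, ENNReal.coe_le_coe]
    exact le_add_self
  · rw [← ha, ENNReal.coe_le_coe]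
    exact le_add_self.trans le_self_add

theorem IsAcim.propM2 (hμ : IsAcim lam f μ) (hI : MeasurableSet I)
    (hI0 : μ I ≠ 0) (h : HasDistortionBoundedBy lam μ I K) : PropM2 lam f μ I K := fun n => by
  rw [(hμ.invariant.iterate n).measure_preimage hI.nullMeasurableSet,
    (hμ.invariant.iterate n).map_eq]
  exact ⟨pos_iff_ne_zero.2 hI0, h.measure_lt_top, h⟩

end Comparable

section InnerRegular

variable {X : Type*} [TopologicalSpace X] [MeasurableSpace X] {lam μ : Measure X} {f : X → X}

theorem exists_isSigmaCompact_subset_measure_eq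
    (hreg : lam.InnerRegularWRT (fun K => IsCompact K ∧ MeasurableSet K) MeasurableSet)
    {B : Set X} (hB : MeasurableSet B) :
    ∃ D ⊆ B, MeasurableSet D ∧ IsSigmaCompact D ∧ lam D = lam B := by
  rcases eq_or_ne (lam B) 0 with h0 | h0
  · exact ⟨∅, empty_subset _, .empty, isSigmaCompact_empty, by simp [h0]⟩
  obtain ⟨r, -, hr, hlim⟩ := exists_seq_strictMono_tendsto' (pos_iff_ne_zero.2 h0)
  choose K hKB hK hlt using fun n => hreg hB (r n) (hr n).2
  refine ⟨⋃ n, K n, iUnion_subset hKB, .iUnion fun n => (hK n).2,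
    isSigmaCompact_iUnion_of_isCompact _ fun n => (hK n).1,
    (measure_mono (iUnion_subset hKB)).antisymm (le_of_tendsto' hlim fun n => ?_)⟩
  exact (hlt n).le.trans (measure_mono (subset_iUnion K n))

theorem exists_isLambdaPartition_of_iUnion
    (hreg : lam.InnerRegularWRT (fun K => IsCompact K ∧ MeasurableSet K) MeasurableSet)
    {E : ℕ → Set X} (hE : ∀ n, MeasurableSet (E n)) (hfin : ∀ n, lam (E n) < ∞)
    (hcov : lam (⋃ n, E n)ᶜ = 0) :
    ∃ G : Set (Set X), IsLambdaPartition lam G ∧ ∀ I ∈ G, ∃ n, I ⊆ E n := by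
  choose D hD hDm hDσ hDlam using fun n =>
    exists_isSigmaCompact_subset_measure_eq hreg (MeasurableSet.disjointed hE n)
  have hDE : ∀ n, D n ⊆ E n := fun n => (hD n).trans (disjointed_subset E n)
  have hDfin : ∀ n, lam (D n) < ∞ := fun n => (measure_mono (hDE n)).trans_lt (hfin n)
  have hae : ∀ n, D n =ᵐ[lam] disjointed E n := fun n =>
    ae_eq_of_subset_of_measure_ge (hD n) (hDlam n).ge (hDm n).nullMeasurableSet
      (hDlam n ▸ hDfin n).ne
  have hcover : ∀ᵐ x ∂lam, ∃ n, 0 < lam (D n) ∧ x ∈ D n := by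
    have hnull : ∀ n, ∀ᵐ x ∂lam, x ∈ D n → 0 < lam (D n) := fun n => by
      rcases eq_or_ne (lam (D n)) 0 with h0 | h0
      · filter_upwards [measure_eq_zero_iff_ae_notMem.1 h0] with x hx hxD using absurd hxD hx
      · exact .of_forall fun _ _ => pos_iff_ne_zero.2 h0
    filter_upwards [measure_eq_zero_iff_ae_notMem.1 hcov, ae_all_iff.2 hnull,
      ae_all_iff.2 fun n => (hae n).mem_iff] with x hx hpos hmem
    rw [notMem_compl_iff, ← iUnion_disjointed, mem_iUnion] at hx
    obtain ⟨n, hn⟩ := hx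
    exact ⟨n, hpos n ((hmem n).2 hn), (hmem n).2 hn⟩
  refine ⟨D '' {n | 0 < lam (D n)}, ⟨(to_countable _).image D, ?_, ?_, ?_, ?_, ?_, ?_⟩, ?_⟩
  · rintro _ ⟨i, -, rfl⟩ _ ⟨j, -, rfl⟩ hij
    exact (disjoint_disjointed E fun h => hij (congrArg D h)).mono (hD i) (hD j)
  · exact forall_mem_image.2 fun n _ => hDm n
  · exact forall_mem_image.2 fun n _ => hDσ n
  · exact forall_mem_image.2 fun n hn => hn
  · exact forall_mem_image.2 fun n _ => hDfin n
  · rw [measure_eq_zero_iff_ae_notMem]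
    filter_upwards [hcover] with x ⟨n, hn, hx⟩ hxG
    exact hxG ⟨D n, mem_image_of_mem D hn, hx⟩
  · exact forall_mem_image.2 fun n _ => ⟨n, hDE n⟩

theorem IsAcim.exists_measMs_nonempty [SigmaFinite lam] (hμ : IsAcim lam f μ)
    (hreg : lam.InnerRegularWRT (fun K => IsCompact K ∧ MeasurableSet K) MeasurableSet)
    (herg : QuasiErgodic f lam) (hcons : Conservative f lam) :
    ∃ G : Set (Set X), IsLambdaPartition lam G ∧ (MeasMs lam G f).Nonempty := by
  have : SigmaFinite μ := hμ.sigmaFinite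
  have hac : lam ≪ μ := hμ.absolutelyContinuous_symm herg hcons
  obtain ⟨E, hE, hfin, hcov, hcomp⟩ := exists_iUnion_comparableOn hμ.absolutelyContinuous hac
  obtain ⟨G, hG, hGE⟩ := exists_isLambdaPartition_of_iUnion hreg hE hfin hcov
  have hdist : ∀ I ∈ G, ∃ C, HasDistortionBoundedBy lam μ I C := fun I hI => by
    obtain ⟨n, hn⟩ := hGE I hI
    exact ⟨_, ((hcomp n).mono hn).hasDistortionBoundedBy hμ.absolutelyContinuous
      (hG.measure_pos I hI).ne' (hG.measure_lt_top I hI).ne⟩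
  refine ⟨G, hG, μ, ⟨hμ.sigmaFinite, fun I hI => ?_⟩, fun I hI => ?_⟩ <;>
    obtain ⟨C, hC⟩ := hdist I hI
  · have hμI : μ I ≠ 0 := fun h0 => (hG.measure_pos I hI).ne' (hac h0)
    obtain ⟨K, hK, hCK, hM1⟩ := exists_propM1 hμI hC.measure_lt_top.ne C
    exact ⟨K, hK, hM1, hμ.propM2 (hG.measurableSet I hI) hμI (hC.mono hCK)⟩
  · simpa only [PropM3, (hμ.invariant.iterate _).measure_preimage
      (hG.measurableSet I hI).nullMeasurableSet, ciSup_const] using hC.measure_lt_top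

end InnerRegular

theorem corollary2p8_general {X : Type*} [TopologicalSpace X] [MeasurableSpace X]
    (lam : Measure X) [SigmaFinite lam] [NeZero lam]
    (hreg : lam.InnerRegularWRT (fun K => IsCompact K ∧ MeasurableSet K) MeasurableSet)
    (f : X → X) (herg : QuasiErgodic f lam) (hcons : Conservative f lam) :
    (∃ μ : Measure X, IsAcim lam f μ) ↔
      ∃ G : Set (Set X), IsLambdaPartition lam G ∧ (MeasMs lam G f).Nonempty := by
  constructor
  · rintro ⟨μ, hμ⟩
    exact hμ.exists_measMs_nonempty hreg herg hcons
  · rintro ⟨G, hG, μ, hμ⟩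
    exact hG.exists_isAcim herg hcons hμ

/-- Measurability of `f` and quasi-invariance of `lam` (`f_* lam ≪ lam`) are part of both
`Conservative f lam` and `QuasiErgodic f lam`. -/
theorem corollary2p8 {X : Type*} [TopologicalSpace X] [SigmaCompactSpace X]
    [MeasurableSpace X] [BorelSpace X]
    (lam : Measure X) [IsProbabilityMeasure lam]
    (hreg : lam.InnerRegularWRT (fun K => IsCompact K ∧ MeasurableSet K) MeasurableSet)
    (f : X → X) (herg : QuasiErgodic f lam) (hcons : Conservative f lam) :
    (∃ μ : Measure X, IsAcim lam f μ) ↔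
      ∃ G : Set (Set X), IsLambdaPartition lam G ∧ (MeasMs lam G f).Nonempty :=
  corollary2p8_general lam hreg f herg hcons
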